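/- Let $G$ be a finite game with finite player set $I$, finite pure strategy sets $S^i$ ($i\in I$) and utility functions $U^i:S=\prod_{j\in I}S^j\to\mathbb{R}$, extended multilinearly to mixed strategy profiles. A correlated equilibrium of $G$ is a probability distribution $\mu$ on $S$ such that, for every $i\in I$ and all $s^i,t^i\in S^i$, $$\sum_{s^{-i}\in S^{-i}}\mu(s^i,s^{-i})\,\bigl[U^i(s^i,s^{-i})-U^i(t^i,s^{-i})\bigr]\ge 0,$$ where $S^{-i}=\prod_{j\ne i}S^j$. Suppose that $G$ has a unique correlated equilibrium $\mu$. Then $\mu$ is a quasi-strict Nash equilibrium; that is, there are mixed strategies $\sigma^i\in\Delta(S^i)$, $i\in I$, such that $\mu(s)=\prod_{i\in I}\sigma^i(s^i)$ for all $s\in S$, the profile $\sigma=(\sigma^i)_{i\in I}$ is a Nash equilibrium of $G$ (for every player $i$ and every mixed strategy $\tau^i\in\Delta(S^i)$, $U^i(\tau^i,\sigma^{-i})\le U^i(\sigma)$), and for every player $i$ every pure best response to $\sigma^{-i}$ lies in the support of $\sigma^i$: if $s^i\in S^i$ satisfies $U^i(s^i,\sigma^{-i})\ge U^i(t^i,\sigma^{-i})$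 for all $t^i\in S^i$, then $\sigma^i(s^i)>0$. -/

import Mathlib

namespace FiniteGame

variable {ι : Type*} [Fintype ι] [DecidableEq ι]
variable {S : ι → Type*} [∀ i, Fintype (S i)] [∀ i, DecidableEq (S i)]

/-- The quantity `h^{a,b}(μ) = ∑_{s^{-i}} μ(a, s^{-i}) (U^i(a, s^{-i}) - U^i(b, s^{-i}))`.
The sum over `s^{-i}` is written as the sum over the profiles `s` whose `i`-th entry is `a`. -/
def incentive (U : ι → (∀ i, S i) → ℝ) (i : ι) (a b : S i) (μ : (∀ i, S i) → ℝ) : ℝ :=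
  ∑ s with s i = a, μ s * (U i s - U i (Function.update s i b))

/-- A correlated equilibrium: a probability distribution over pure strategy profiles that
satisfies all the incentive constraints. -/
def IsCorrelatedEquilibrium (U : ι → (∀ i, S i) → ℝ) (μ : (∀ i, S i) → ℝ) : Prop :=
  μ ∈ stdSimplex ℝ (∀ i, S i) ∧ ∀ (i : ι) (a b : S i), 0 ≤ incentive U i a b μ

/-- A profile of mixed strategies, one for each player. -/
def IsMixedProfile (σ : ∀ i, S i → ℝ) : Prop :=
  ∀ i, σ i ∈ stdSimplex ℝ (S i)

/-- The distribution over pure strategy profiles induced by independent play of `σ`. -/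
def productDist (σ : ∀ i, S i → ℝ) : (∀ i, S i) → ℝ :=
  fun s => ∏ i, σ i (s i)

/-- The multilinear extension of the utility function of player `i`, at the mixed profile `σ`. -/
def expectedUtility (U : ι → (∀ i, S i) → ℝ) (i : ι) (σ : ∀ i, S i → ℝ) : ℝ :=
  ∑ s, productDist σ s * U i s

/-- `U^i(τ, σ^{-i})`: player `i` plays the mixed strategy `τ`, the others follow `σ`. -/
def deviationUtility (U : ι → (∀ i, S i) → ℝ) (σ : ∀ i, S i → ℝ) (i : ι) (τ : S i → ℝ) : ℝ :=
  expectedUtility U i (Function.update σ i τ)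

/-- Nash equilibrium in mixed strategies: no player gains by deviating to another mixed strategy. -/
def IsNashEquilibrium (U : ι → (∀ i, S i) → ℝ) (σ : ∀ i, S i → ℝ) : Prop :=
  IsMixedProfile σ ∧
    ∀ (i : ι), ∀ τ ∈ stdSimplex ℝ (S i), deviationUtility U σ i τ ≤ expectedUtility U i σ

/-- The pure best responses of player `i` to `σ^{-i}`; the pure strategy `a` is identified with
the point mass `Pi.single a 1`. -/
def pureBestResponses (U : ι → (∀ i, S i) → ℝ) (σ : ∀ i, S i → ℝ) (i : ι) : Set (S i) :=
  {a | ∀ b : S i, deviationUtility U σ i (Pi.single b 1) ≤ deviationUtility U σ i (Pi.single a 1)}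

/-- The support of a mixed strategy of one player. -/
def mixedSupport {T : Type*} (τ : T → ℝ) : Set T :=
  {a | 0 < τ a}

/-- A quasi-strict Nash equilibrium: a Nash equilibrium such that every pure best response of
a player belongs to the support of the strategy of this player. -/
def IsQuasiStrictNash (U : ι → (∀ i, S i) → ℝ) (σ : ∀ i, S i → ℝ) : Prop :=
  IsNashEquilibrium U σ ∧ ∀ i, pureBestResponses U σ i ⊆ mixedSupport (σ i)

end FiniteGame

/-! Correlated equilibria are the normalized solutions of a finite homogeneous linear system, so
Farkas' lemma yields multipliers `α` (incentives) and `β` (nonnegativity) that are strictly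
complementary to them. Read `α i a b` as a flow rate from `a` to `b`. If every player but `i` uses a
strategy balanced for this flow, their terms cancel in the dual identity: the expected slack `β`
when `i` plays `a` equals the `α`-weighted gain of `i` from leaving `a`
(`IsDualVector.sum_productDist_update_mul`).

Dual reduction replaces each strategy set by the recurrent classes of `α i`. A maximum principle
shows that its correlated equilibria lift to the game, and the lift is injective, so uniqueness is
inherited. Induction on the number of strategies then gives a product equilibrium without a fixed
point theorem: if no `α` acts between distinct strategies, complementarity and uniqueness leave only
one profile.

Hence `μ` is a product of balanced strategies `σ i`. If `σ i a = 0`, complementarity makes `β`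
positive on all profiles containing `a`, so by the identity leaving `a` is profitable on
`α`-average, and `a` is not a best response. -/

namespace FiniteGame

/-! ### Linear inequalities and strict complementarity -/

/-- **Farkas' lemma** for a finite family of linear functionals. -/
theorem farkas {V K : Type*} [AddCommGroup V] [Module ℝ V] (s : Finset K)
    (L : K → V →ₗ[ℝ] ℝ) (f : V →ₗ[ℝ] ℝ)
    (h : ∀ x, (∀ k ∈ s, 0 ≤ L k x) → 0 ≤ f x) :
    ∃ c : K → ℝ, (∀ k, 0 ≤ c k) ∧ f = ∑ k ∈ s, c k • L k := by
  classical
  induction s using Finset.induction_on generalizing L f with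
  | empty =>
    refine ⟨0, fun _ => le_rfl, ?_⟩
    ext x
    have h₁ := h x (by simp)
    have h₂ := h (-x) (by simp)
    simp only [map_neg] at h₂
    simp only [Finset.sum_empty, LinearMap.zero_apply]
    linarith
  | insert k₀ s hk₀ ih =>
    by_cases hs : ∀ x, (∀ k ∈ s, 0 ≤ L k x) → 0 ≤ f x
    · obtain ⟨c, hc, hf⟩ := ih L f hs
      refine ⟨Function.update c k₀ 0, fun k => ?_, ?_⟩
      · by_cases hk : k = k₀
        · simp [hk]
        · simpa [hk] using hc k
      · rw [Finset.sum_insert hk₀, hf]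
        simp only [Function.update_self, zero_smul, zero_add]
        refine Finset.sum_congr rfl fun k hk => ?_
        rw [Function.update_of_ne (ne_of_mem_of_not_mem hk hk₀)]
    · push Not at hs
      obtain ⟨x, hx, hfx⟩ := hs
      have hneg : L k₀ x < 0 := by
        by_contra! hpos
        exact absurd (h x (by simpa using ⟨hpos, hx⟩)) (not_le.mpr hfx)
      -- With `L k₀ y = -1`, the map `z ↦ z + L k₀ z • y` projects onto the kernel of `L k₀`. The
      -- induction hypothesis is applied to the functionals composed with it.
      set y : V := (-(L k₀ x))⁻¹ • x with hy
      have hr : 0 < (-(L k₀ x))⁻¹ := inv_pos.mpr (neg_pos.mpr hneg)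
      have hy₀ : L k₀ y = -1 := by
        simp only [hy, map_smul, smul_eq_mul]
        have := hneg.ne
        field_simp
      have hys : ∀ k ∈ s, 0 ≤ L k y := fun k hk => by
        simpa [hy] using mul_nonneg hr.le (hx k hk)
      have hfy : f y < 0 := by
        simpa only [hy, map_smul, smul_eq_mul] using mul_neg_of_pos_of_neg hr hfx
      obtain ⟨c, hc, hf⟩ := ih (fun k => L k + L k y • L k₀) (f + f y • L k₀) (fun z hz => by
        have := h (z + L k₀ z • y) (fun k hk => by
          rcases Finset.mem_insert.mp hk with rfl | hk
          · simp [hy₀]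
          · have := hz k hk
            simp only [LinearMap.add_apply, LinearMap.smul_apply, smul_eq_mul] at this
            simp only [map_add, map_smul, smul_eq_mul]
            linarith)
        simp only [map_add, map_smul, smul_eq_mul] at this
        simp only [LinearMap.add_apply, LinearMap.smul_apply, smul_eq_mul]
        linarith)
      -- This coefficient comes from solving `hf` for `f`; it is nonnegative because `f y < 0 ≤ L k
      -- y`.
      refine ⟨Function.update c k₀ (∑ k ∈ s, c k * L k y - f y), fun k => ?_, ?_⟩
      · by_cases hk : k = k₀
        · subst hk
          have := Finset.sum_nonneg fun k hk => mul_nonneg (hc k) (hys k hk)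
          simp only [Function.update_self]
          linarith
        · simpa [hk] using hc k
      · have hsum : ∑ k ∈ s, Function.update c k₀ (∑ k ∈ s, c k * L k y - f y) k • L k
            = ∑ k ∈ s, c k • L k := Finset.sum_congr rfl fun k hk => by
          rw [Function.update_of_ne (ne_of_mem_of_not_mem hk hk₀)]
        rw [Finset.sum_insert hk₀, hsum, Function.update_self]
        ext z
        have := congrArg (fun g => g z) hf
        simp only [LinearMap.add_apply, LinearMap.smul_apply, smul_eq_mul, LinearMap.sum_apply,
          mul_add, Finset.sum_add_distrib] at this ⊢
        rw [sub_mul, Finset.sum_mul]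
        simp only [mul_assoc]
        linarith

/-- Strict complementarity for a finite system of homogeneous linear inequalities. -/
theorem exists_strictly_complementary {V K : Type*} [AddCommGroup V] [Module ℝ V] [Fintype K]
    (L : K → V →ₗ[ℝ] ℝ) :
    ∃ c : K → ℝ, (∀ k, 0 ≤ c k) ∧ ∑ k, c k • L k = 0 ∧
      ∀ k, 0 < c k ∨ ∃ x, (∀ j, 0 ≤ L j x) ∧ 0 < L k x := by
  classical
  have key : ∀ k, ∃ c : K → ℝ, (∀ j, 0 ≤ c j) ∧ ∑ j, c j • L j = 0 ∧
      (0 < c k ∨ ∃ x, (∀ j, 0 ≤ L j x) ∧ 0 < L k x) := by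
    intro k
    by_cases hk : ∃ x, (∀ j, 0 ≤ L j x) ∧ 0 < L k x
    · exact ⟨0, fun _ => le_rfl, by simp, Or.inr hk⟩
    · push Not at hk
      -- Here `-L k` is nonnegative on the cone. Moving it across its Farkas representation adds 1
      -- to the coefficient of `L k`.
      obtain ⟨c, hc, hf⟩ := farkas Finset.univ L (-L k) (fun x hx => by
        simpa using hk x fun j => hx j (Finset.mem_univ j))
      refine ⟨c + Pi.single k 1, fun j => ?_, ?_, Or.inl ?_⟩
      · exact add_nonneg (hc j) (by by_cases h : j = k <;> simp [h])
      · simp [add_smul, Finset.sum_add_distrib, ← hf, Pi.single_apply]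
      · simpa using add_pos_of_nonneg_of_pos (hc k) one_pos
  choose c hc hsum hpos using key
  -- Summing the relations found for the separate `k` serves all of them at once.
  refine ⟨fun j => ∑ k, c k j, fun j => Finset.sum_nonneg fun k _ => hc k j, ?_, fun k => ?_⟩
  · simp only [Finset.sum_smul]
    rw [Finset.sum_comm]
    simp [hsum]
  · refine (hpos k).imp_left fun h => ?_
    exact Finset.sum_pos' (fun j _ => hc j k) ⟨k, Finset.mem_univ k, h⟩

/-! ### Balanced vectors and recurrent classes of a finite flow -/

section Balanced

variable {A : Type*} [Fintype A]

/-- A vector `x` is balanced for the weights `w` if the flow `x a * w a b` into every state equals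
the flow out of it. -/
def Balanced (w : A → A → ℝ) (x : A → ℝ) : Prop :=
  ∀ b, ∑ a, x a * w a b = x b * ∑ c, w b c

/-- What enters a state also leaves it, so each value of `f` is gained and lost equally often. -/
theorem Balanced.sum_mul_gain {w : A → A → ℝ} {x : A → ℝ} (hx : Balanced w x) (f : A → ℝ) :
    ∑ a, x a * ∑ b, w a b * (f b - f a) = 0 := by
  have h₁ : ∑ a, x a * ∑ b, w a b * f b = ∑ b, (∑ a, x a * w a b) * f b := by
    simp only [Finset.mul_sum, Finset.sum_mul]
    rw [Finset.sum_comm]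
    simp only [mul_assoc]
  have h₂ : ∑ a, x a * ∑ b, w a b * f a = ∑ a, (x a * ∑ b, w a b) * f a := by
    simp only [Finset.mul_sum, Finset.sum_mul, mul_assoc]
  simp only [mul_sub, Finset.sum_sub_distrib, h₁, h₂]
  rw [sub_eq_zero]
  exact Finset.sum_congr rfl fun b _ => by rw [hx b]

theorem Balanced.add {w : A → A → ℝ} {x y : A → ℝ} (hx : Balanced w x) (hy : Balanced w y) :
    Balanced w (x + y) := fun b => by
  simp only [Pi.add_apply, add_mul, Finset.sum_add_distrib, hx b, hy b]

theorem Balanced.smul {w : A → A → ℝ} {x : A → ℝ} (hx : Balanced w x) (r : ℝ) :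
    Balanced w (r • x) := fun b => by
  simp only [Pi.smul_apply, smul_eq_mul, mul_assoc, ← Finset.mul_sum, hx b]

theorem Balanced.sub {w : A → A → ℝ} {x y : A → ℝ} (hx : Balanced w x) (hy : Balanced w y) :
    Balanced w (x - y) := by
  simpa [sub_eq_add_neg] using hx.add (hy.smul (-1))

theorem Balanced.sum {w : A → A → ℝ} {K : Type*} (s : Finset K) {x : K → A → ℝ}
    (hx : ∀ k ∈ s, Balanced w (x k)) : Balanced w (∑ k ∈ s, x k) :=
  Finset.sum_induction _ (Balanced w) (fun _ _ => Balanced.add) (fun b => by simp) hx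

/-- By the triangle inequality the inflow of `|x|` is at least its outflow at every state; the
totals agree, so equality holds everywhere. -/
theorem Balanced.abs {w : A → A → ℝ} (hw : ∀ a b, 0 ≤ w a b) {x : A → ℝ} (hx : Balanced w x) :
    Balanced w (fun a => |x a|) := by
  have hle : ∀ b ∈ Finset.univ, |x b| * ∑ c, w b c ≤ ∑ a, |x a| * w a b := fun b _ => by
    have hr : 0 ≤ ∑ c, w b c := Finset.sum_nonneg fun c _ => hw b c
    calc |x b| * ∑ c, w b c = |∑ a, x a * w a b| := by rw [hx b, abs_mul, abs_of_nonneg hr]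
      _ ≤ ∑ a, |x a * w a b| := Finset.abs_sum_le_sum_abs _ _
      _ = ∑ a, |x a| * w a b := Finset.sum_congr rfl fun a _ => by
        rw [abs_mul, abs_of_nonneg (hw a b)]
  have hsum : ∑ b, |x b| * ∑ c, w b c = ∑ b, ∑ a, |x a| * w a b := by
    rw [Finset.sum_comm]
    simp only [Finset.mul_sum]
  intro b
  exact ((Finset.sum_eq_sum_iff_of_le hle).mp hsum b (Finset.mem_univ b)).symm

/-- Every finite system of nonnegative weights has a balanced probability vector. -/
theorem exists_balanced_mem_stdSimplex [Nonempty A] (w : A → A → ℝ) (hw : ∀ a b, 0 ≤ w a b) :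
    ∃ x ∈ stdSimplex ℝ A, Balanced w x := by
  classical
  -- The generator of the flow: its rows sum to zero, so it is singular, and its left kernel
  -- consists of balanced vectors.
  let M : Matrix A A ℝ := fun a b => w a b - if a = b then ∑ c, w a c else 0
  have hM : M.det = 0 := by
    refine Matrix.exists_mulVec_eq_zero_iff.mp ⟨fun _ => 1, fun h => ?_, ?_⟩
    · simpa using congrFun h (Classical.arbitrary A)
    · ext a
      simp [M, Matrix.mulVec, dotProduct]
  obtain ⟨v, hv, hvM⟩ := Matrix.exists_vecMul_eq_zero_iff.mpr hM
  have hbal : Balanced w v := fun b => by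
    have := congrFun hvM b
    simp only [M, Matrix.vecMul, dotProduct, mul_sub, Finset.sum_sub_distrib, mul_ite, mul_zero,
      Finset.sum_ite_eq', Finset.mem_univ, if_true, Pi.zero_apply] at this
    linarith
  obtain ⟨a, ha⟩ : ∃ a, v a ≠ 0 := by
    by_contra! h
    exact hv (funext h)
  have hpos : 0 < ∑ a, |v a| :=
    Finset.sum_pos' (fun _ _ => abs_nonneg _) ⟨a, Finset.mem_univ a, abs_pos.mpr ha⟩
  refine ⟨(∑ a, |v a|)⁻¹ • fun a => |v a|, ⟨fun b => ?_, ?_⟩, (hbal.abs hw).smul _⟩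
  · exact mul_nonneg (inv_nonneg.mpr hpos.le) (abs_nonneg _)
  · simp only [Pi.smul_apply, smul_eq_mul, ← Finset.mul_sum]
    exact inv_mul_cancel₀ hpos.ne'

/-- A nonempty set of states that the weights do not leave carries a balanced probability vector. -/
theorem exists_balanced_supported (w : A → A → ℝ) (hw : ∀ a b, 0 ≤ w a b) (M : Set A)
    (hM : M.Nonempty) (hclosed : ∀ a ∈ M, ∀ b ∉ M, w a b = 0) :
    ∃ x ∈ stdSimplex ℝ A, Balanced w x ∧ ∀ a ∉ M, x a = 0 := by
  classical
  have : Nonempty M := hM.to_subtype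
  obtain ⟨x, hx, hbal⟩ := exists_balanced_mem_stdSimplex (fun a b : M => w a b)
    (fun a b => hw a b)
  have hsum : ∀ g : A → ℝ, ∑ a, (if h : a ∈ M then x ⟨a, h⟩ else 0) * g a = ∑ a : M, x a * g a := by
    intro g
    rw [← Finset.sum_subset (Finset.subset_univ (M.toFinset))]
    · rw [← Finset.sum_subtype (M.toFinset) (p := (· ∈ M)) (by simp)
        (fun a => (if h : a ∈ M then x ⟨a, h⟩ else 0) * g a) |>.symm]
      refine Finset.sum_congr rfl fun a _ => by simp
    · intro a _ ha
      simp [Set.mem_toFinset.not.mp ha]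
  refine ⟨fun a => if h : a ∈ M then x ⟨a, h⟩ else 0, ⟨fun a => ?_, ?_⟩, fun b => ?_, fun a ha => ?_⟩
  · dsimp only
    split_ifs with h
    · exact hx.1 _
    · exact le_rfl
  · have := hsum 1
    simpa [hx.2] using this
  · rw [hsum fun a => w a b]
    by_cases hb : b ∈ M
    · have h₂ : ∑ c : M, w b c = ∑ c, w b c := by
        rw [← Finset.sum_subset (Finset.subset_univ (M.toFinset))]
        · exact (Finset.sum_subtype (M.toFinset) (by simp) fun c => w b c).symm
        · intro c _ hc
          exact hclosed b hb c (by simpa using hc)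
      rw [hbal ⟨b, hb⟩, h₂]
      simp [hb]
    · simp only [hb, dif_neg, not_false_eq_true, zero_mul]
      exact Finset.sum_eq_zero fun a _ => by rw [hclosed a a.2 b hb, mul_zero]
  · simp [ha]

/-- `B` is the support of a nonzero nonnegative balanced vector. -/
def IsBalancedSupport (w : A → A → ℝ) (B : Finset A) : Prop :=
  B.Nonempty ∧ ∃ x : A → ℝ, (∀ a, 0 ≤ x a) ∧ Balanced w x ∧ ∀ a, 0 < x a ↔ a ∈ B

/-- The recurrent classes of the weights `w`: the minimal supports of balanced vectors. -/
def RecurrentClass (w : A → A → ℝ) : Type _ :=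
  {B : Finset A // Minimal (IsBalancedSupport w) B}

noncomputable instance (w : A → A → ℝ) : Fintype (RecurrentClass w) :=
  @Subtype.fintype _ _ (Classical.decPred _) _

noncomputable instance (w : A → A → ℝ) : DecidableEq (RecurrentClass w) :=
  Classical.decEq _

theorem RecurrentClass.exists_dist {w : A → A → ℝ} (t : RecurrentClass w) :
    ∃ x ∈ stdSimplex ℝ A, Balanced w x ∧ ∀ a, 0 < x a ↔ a ∈ t.1 := by
  obtain ⟨⟨⟨a, ha⟩, x, hx, hbal, hsupp⟩, -⟩ := t.2
  have hpos : 0 < ∑ a, x a :=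
    Finset.sum_pos' (fun b _ => hx b) ⟨a, Finset.mem_univ a, (hsupp a).mpr ha⟩
  refine ⟨(∑ a, x a)⁻¹ • x, ⟨fun b => ?_, ?_⟩, hbal.smul _, fun b => ?_⟩
  · exact mul_nonneg (inv_nonneg.mpr hpos.le) (hx b)
  · simp only [Pi.smul_apply, smul_eq_mul, ← Finset.mul_sum]
    exact inv_mul_cancel₀ hpos.ne'
  · rw [← hsupp b]
    exact mul_pos_iff_of_pos_left (inv_pos.mpr hpos)

/-- A balanced probability vector carried by a recurrent class. -/
noncomputable def RecurrentClass.dist {w : A → A → ℝ} (t : RecurrentClass w) : A → ℝ :=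
  t.exists_dist.choose

theorem RecurrentClass.dist_mem {w : A → A → ℝ} (t : RecurrentClass w) :
    t.dist ∈ stdSimplex ℝ A := t.exists_dist.choose_spec.1

theorem RecurrentClass.balanced_dist {w : A → A → ℝ} (t : RecurrentClass w) :
    Balanced w t.dist := t.exists_dist.choose_spec.2.1

theorem RecurrentClass.dist_pos_iff {w : A → A → ℝ} (t : RecurrentClass w) (a : A) :
    0 < t.dist a ↔ a ∈ t.1 := t.exists_dist.choose_spec.2.2 a

theorem RecurrentClass.exists_dist_pos {w : A → A → ℝ} (t : RecurrentClass w) :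
    ∃ a, 0 < t.dist a := by
  obtain ⟨a, ha⟩ := t.2.prop.1
  exact ⟨a, (t.dist_pos_iff a).mpr ha⟩

/-- Distinct recurrent classes are disjoint. -/
theorem RecurrentClass.eq_of_dist_pos {w : A → A → ℝ} (hw : ∀ a b, 0 ≤ w a b)
    {t t' : RecurrentClass w} {a : A} (h : 0 < t.dist a) (h' : 0 < t'.dist a) : t = t' := by
  classical
  -- The pointwise minimum, in a form that is visibly balanced. Its support is the intersection of
  -- the classes, so minimality identifies them.
  let z : A → ℝ := (1 / 2 : ℝ) • (t.dist + t'.dist - fun a => |(t.dist - t'.dist) a|)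
  have hz : ∀ b, z b = min (t.dist b) (t'.dist b) := fun b => by
    simp only [z, Pi.smul_apply, Pi.sub_apply, Pi.add_apply, smul_eq_mul]
    rcases le_total (t.dist b) (t'.dist b) with hb | hb
    · rw [min_eq_left hb, abs_of_nonpos (by linarith)]; ring
    · rw [min_eq_right hb, abs_of_nonneg (by linarith)]; ring
  have hbal : Balanced w z := ((t.balanced_dist.add t'.balanced_dist).sub
    ((t.balanced_dist.sub t'.balanced_dist).abs hw)).smul _
  have hsupp : IsBalancedSupport w (t.1 ∩ t'.1) := by
    refine ⟨⟨a, Finset.mem_inter.mpr ⟨(t.dist_pos_iff a).mp h, (t'.dist_pos_iff a).mp h'⟩⟩, z,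
      fun b => ?_, hbal, fun b => ?_⟩
    · rw [hz]
      exact le_min (t.dist_mem.1 b) (t'.dist_mem.1 b)
    · rw [hz, lt_min_iff, t.dist_pos_iff, t'.dist_pos_iff, Finset.mem_inter]
  exact Subtype.ext <| le_antisymm
    ((t.2.le_of_le hsupp Finset.inter_subset_left).trans Finset.inter_subset_right)
    ((t'.2.le_of_le hsupp Finset.inter_subset_right).trans Finset.inter_subset_left)

/-- Every nonnegative balanced vector is a nonnegative combination of the distributions carried
by the recurrent classes. -/
theorem Balanced.exists_eq_sum {w : A → A → ℝ} {x : A → ℝ} (hx : Balanced w x)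
    (hnn : ∀ a, 0 ≤ x a) :
    ∃ c : RecurrentClass w → ℝ, (∀ t, 0 ≤ c t) ∧ ∀ a, x a = ∑ t, c t * t.dist a := by
  classical
  induction hn : (Finset.univ.filter fun a => 0 < x a).card using Nat.strong_induction_on
    generalizing x with
  | _ n ih =>
  by_cases hne : (Finset.univ.filter fun a => 0 < x a).Nonempty
  · have hsupp : IsBalancedSupport w (Finset.univ.filter fun a => 0 < x a) :=
      ⟨hne, x, hnn, hx, fun a => by simp⟩
    obtain ⟨B, hB, hmin⟩ := exists_minimal_le_of_wellFoundedLT _ _ hsupp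
    let t : RecurrentClass w := ⟨B, hmin⟩
    -- The minimal ratio is the largest multiple of `t.dist` that can be subtracted while staying
    -- nonnegative; it removes `a₀` from the support.
    obtain ⟨a₀, ha₀, hle⟩ := Finset.exists_min_image B (fun a => x a / t.dist a) hmin.prop.1
    have ht₀ : 0 < t.dist a₀ := (t.dist_pos_iff a₀).mpr ha₀
    have hx₀ : 0 < x a₀ := by simpa using hB ha₀
    set r := x a₀ / t.dist a₀ with hr
    have hr₀ : 0 ≤ r := (div_pos hx₀ ht₀).le
    have hy : ∀ a, 0 ≤ (x - r • t.dist) a := fun a => by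
      simp only [Pi.sub_apply, Pi.smul_apply, smul_eq_mul, sub_nonneg]
      by_cases ha : a ∈ B
      · exact (le_div_iff₀ ((t.dist_pos_iff a).mpr ha)).mp (hle a ha)
      · have : t.dist a = 0 :=
          le_antisymm (not_lt.mp fun h => ha ((t.dist_pos_iff a).mp h)) (t.dist_mem.1 a)
        rw [this, mul_zero]
        exact hnn a
    have hlt : (Finset.univ.filter fun a => 0 < (x - r • t.dist) a).card < n := by
      rw [← hn]
      refine Finset.card_lt_card ⟨fun a => ?_, fun hsub => ?_⟩
      · simp only [Finset.mem_filter, Finset.mem_univ, true_and, Pi.sub_apply, Pi.smul_apply,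
          smul_eq_mul]
        intro ha
        have := mul_nonneg hr₀ (t.dist_mem.1 a)
        linarith
      · have := hsub (Finset.mem_filter.mpr ⟨Finset.mem_univ a₀, hx₀⟩)
        simp [hr, div_mul_cancel₀ _ ht₀.ne'] at this
    obtain ⟨c, hc, hsum⟩ := ih _ hlt (hx.sub (t.balanced_dist.smul r)) hy rfl
    refine ⟨c + Pi.single t r, fun u => add_nonneg (hc u) ?_, fun a => ?_⟩
    · by_cases h : u = t <;> simp [h, hr₀]
    · have := hsum a
      simp only [Pi.sub_apply, Pi.smul_apply, smul_eq_mul] at this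
      simp only [Pi.add_apply, add_mul, Finset.sum_add_distrib, Pi.single_apply, ite_mul, zero_mul,
        Finset.sum_ite_eq', Finset.mem_univ, if_true]
      linarith
  · refine ⟨0, fun _ => le_rfl, fun a => ?_⟩
    rw [Finset.not_nonempty_iff_eq_empty, Finset.filter_eq_empty_iff] at hne
    simpa using le_antisymm (not_lt.mp (hne (Finset.mem_univ a))) (hnn a)

theorem RecurrentClass.nonempty [Nonempty A] {w : A → A → ℝ} (hw : ∀ a b, 0 ≤ w a b) :
    Nonempty (RecurrentClass w) := by
  obtain ⟨x, hx, hbal⟩ := exists_balanced_mem_stdSimplex w hw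
  obtain ⟨c, -, hc⟩ := hbal.exists_eq_sum hx.1
  by_contra hne
  rw [not_nonempty_iff] at hne
  have := hx.2
  simp [hc] at this

/-- Maximum principle: a subharmonic function is bounded by its averages over the recurrent
classes. -/
theorem le_of_forall_recurrentClass_le {w : A → A → ℝ} (hw : ∀ a b, 0 ≤ w a b) {f : A → ℝ} {v : ℝ}
    (hf : ∀ a, 0 ≤ ∑ b, w a b * (f b - f a))
    (hv : ∀ t : RecurrentClass w, ∑ a, t.dist a * f a ≤ v) (a : A) : f a ≤ v := by
  have : Nonempty A := ⟨a⟩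
  obtain ⟨m, hm⟩ := Finite.exists_max f
  -- At a maximizer all gains are nonpositive with nonnegative weighted sum, so the flow never
  -- leaves the set of maximizers.
  obtain ⟨x, hx, hbal, hsupp⟩ := exists_balanced_supported w hw {b | f b = f m} ⟨m, rfl⟩
    (fun b hb c hc => by
      have hb : f b = f m := hb
      have hterm : ∀ d ∈ Finset.univ, w b d * (f d - f b) ≤ 0 := fun d _ =>
        mul_nonpos_of_nonneg_of_nonpos (hw b d) (by linarith [hm d])
      have hzero := (Finset.sum_eq_zero_iff_of_nonpos hterm).mp
        (le_antisymm (Finset.sum_nonpos hterm) (hf b)) c (Finset.mem_univ c)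
      refine (mul_eq_zero.mp hzero).resolve_right fun h => hc ?_
      have : f c = f m := by linarith
      exact this)
  obtain ⟨c, hc, hsum⟩ := hbal.exists_eq_sum hx.1
  have h₁ : ∑ b, x b * f b = f m := by
    have : ∀ b ∈ Finset.univ, x b * f b = x b * f m := fun b _ => by
      by_cases hb : f b = f m
      · rw [hb]
      · rw [hsupp b hb]; simp
    rw [Finset.sum_congr rfl this, ← Finset.sum_mul, hx.2, one_mul]
  have h₂ : ∀ g : A → ℝ, ∑ b, x b * g b = ∑ t, c t * ∑ b, t.dist b * g b := fun g => by
    simp only [hsum, Finset.sum_mul, Finset.mul_sum, mul_assoc]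
    exact Finset.sum_comm
  have h₃ : ∑ t, c t = 1 := by
    have := h₂ 1
    simp only [Pi.one_apply, mul_one, hx.2, (RecurrentClass.dist_mem _).2] at this
    exact this.symm
  calc f a ≤ f m := hm a
    _ = ∑ t, c t * ∑ b, t.dist b * f b := by rw [← h₁, h₂]
    _ ≤ ∑ t, c t * v := Finset.sum_le_sum fun t _ => mul_le_mul_of_nonneg_left (hv t) (hc t)
    _ = v := by rw [← Finset.sum_mul, h₃, one_mul]

theorem RecurrentClass.card_le {w : A → A → ℝ} (hw : ∀ a b, 0 ≤ w a b) :
    Fintype.card (RecurrentClass w) ≤ Fintype.card A := by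
  choose g hg using fun t : RecurrentClass w => t.exists_dist_pos
  exact Fintype.card_le_of_injective g fun t t' h =>
    RecurrentClass.eq_of_dist_pos hw (hg t) (h ▸ hg t')

/-- With as many disjoint classes as states, each class would be a single state, and balance there
forbids flow to any other state. -/
theorem RecurrentClass.card_lt {w : A → A → ℝ} (hw : ∀ a b, 0 ≤ w a b) {a b : A} (hab : a ≠ b)
    (hwab : w a b ≠ 0) : Fintype.card (RecurrentClass w) < Fintype.card A := by
  choose g hg using fun t : RecurrentClass w => t.exists_dist_pos
  have hinj : Function.Injective g := fun t t' h =>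
    RecurrentClass.eq_of_dist_pos hw (hg t) (h ▸ hg t')
  refine lt_of_le_of_ne (RecurrentClass.card_le hw) fun hcard => ?_
  have hsurj := ((Fintype.bijective_iff_injective_and_card g).mpr ⟨hinj, hcard⟩).2
  obtain ⟨t, rfl⟩ := hsurj a
  have hzero : ∀ c, c ≠ g t → t.dist c = 0 := fun c hc => by
    refine le_antisymm (not_lt.mp fun hpos => hc ?_) (t.dist_mem.1 c)
    obtain ⟨t', rfl⟩ := hsurj c
    rw [RecurrentClass.eq_of_dist_pos hw (hg t') hpos]
  have hbal := t.balanced_dist b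
  rw [hzero b hab.symm, zero_mul, Finset.sum_eq_single (g t)] at hbal
  · exact (mul_ne_zero (hg t).ne' hwab) hbal
  · intro c _ hc
    rw [hzero c hc, zero_mul]
  · simp

end Balanced

set_option linter.unusedSectionVars false

/-! ### Product distributions and incentives -/

section Game

variable {ι : Type*} [Fintype ι] [DecidableEq ι]
variable {S : ι → Type*} [∀ i, Fintype (S i)] [∀ i, DecidableEq (S i)]

theorem productDist_nonneg {σ : ∀ i, S i → ℝ} (hσ : IsMixedProfile σ) (s : ∀ i, S i) :
    0 ≤ productDist σ s :=
  Finset.prod_nonneg fun i _ => (hσ i).1 (s i)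

theorem productDist_mem_stdSimplex {σ : ∀ i, S i → ℝ} (hσ : IsMixedProfile σ) :
    productDist σ ∈ stdSimplex ℝ (∀ i, S i) := by
  refine ⟨productDist_nonneg hσ, ?_⟩
  simp only [productDist]
  rw [← Fintype.prod_sum]
  exact Finset.prod_eq_one fun i _ => (hσ i).2

theorem isMixedProfile_update {σ : ∀ i, S i → ℝ} (hσ : IsMixedProfile σ) {i : ι} {τ : S i → ℝ}
    (hτ : τ ∈ stdSimplex ℝ (S i)) : IsMixedProfile (Function.update σ i τ) := fun j => by
  by_cases hj : j = i
  · subst hj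
    simpa using hτ
  · simpa [hj] using hσ j

theorem productDist_eq_mul_erase (σ : ∀ i, S i → ℝ) (i : ι) (s : ∀ i, S i) :
    productDist σ s = σ i (s i) * ∏ j ∈ Finset.univ.erase i, σ j (s j) :=
  (Finset.mul_prod_erase _ _ (Finset.mem_univ i)).symm

theorem productDist_update (σ : ∀ i, S i → ℝ) (i : ι) (τ : S i → ℝ) (s : ∀ i, S i) :
    productDist (Function.update σ i τ) s =
      τ (s i) * ∏ j ∈ Finset.univ.erase i, σ j (s j) := by
  rw [productDist_eq_mul_erase _ i, Function.update_self]
  congr 1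
  exact Finset.prod_congr rfl fun j hj => by
    rw [Function.update_of_ne (Finset.ne_of_mem_erase hj)]

theorem sum_filter_update {i : ι} (a b : S i) (F : (∀ i, S i) → ℝ) :
    ∑ s with s i = a, F (Function.update s i b) = ∑ s with s i = b, F s := by
  refine Finset.sum_nbij' (fun s => Function.update s i b) (fun s => Function.update s i a)
    ?_ ?_ ?_ ?_ ?_
  · simp
  · simp
  · intro s hs
    rw [Finset.mem_filter] at hs
    simp [← hs.2]
  · intro s hs
    rw [Finset.mem_filter] at hs
    simp [← hs.2]
  · simp

theorem deviationUtility_single (U : ι → (∀ i, S i) → ℝ) (σ : ∀ i, S i → ℝ) (i : ι) (b : S i) :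
    deviationUtility U σ i (Pi.single b 1) =
      ∑ s with s i = b, (∏ j ∈ Finset.univ.erase i, σ j (s j)) * U i s := by
  simp only [deviationUtility, expectedUtility, productDist_update]
  rw [Finset.sum_filter]
  refine Finset.sum_congr rfl fun s _ => ?_
  by_cases h : s i = b <;> simp [h]

theorem deviationUtility_single_eq_sum_update (U : ι → (∀ i, S i) → ℝ) (σ : ∀ i, S i → ℝ) (i : ι)
    (a b : S i) :
    deviationUtility U σ i (Pi.single b 1) =
      ∑ s with s i = a, (∏ j ∈ Finset.univ.erase i, σ j (s j)) * U i (Function.update s i b) := by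
  rw [deviationUtility_single, ← sum_filter_update a b]
  refine Finset.sum_congr rfl fun s _ => ?_
  congr 1
  exact Finset.prod_congr rfl fun j hj => by
    rw [Function.update_of_ne (Finset.ne_of_mem_erase hj)]

theorem deviationUtility_eq_sum (U : ι → (∀ i, S i) → ℝ) (σ : ∀ i, S i → ℝ) (i : ι)
    (τ : S i → ℝ) :
    deviationUtility U σ i τ = ∑ a, τ a * deviationUtility U σ i (Pi.single a 1) := by
  simp only [deviationUtility_single]
  simp only [deviationUtility, expectedUtility, productDist_update]
  rw [← Finset.sum_fiberwise Finset.univ (fun s => s i)]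
  refine Finset.sum_congr rfl fun a _ => ?_
  rw [Finset.mul_sum]
  refine Finset.sum_congr rfl fun s hs => ?_
  rw [(Finset.mem_filter.mp hs).2, mul_assoc]

/-- Under independent play, the recommendation `a` carries no information about the other players.
-/
theorem incentive_productDist (U : ι → (∀ i, S i) → ℝ) (σ : ∀ i, S i → ℝ) (i : ι) (a b : S i) :
    incentive U i a b (productDist σ) = σ i a *
      (deviationUtility U σ i (Pi.single a 1) - deviationUtility U σ i (Pi.single b 1)) := by
  rw [deviationUtility_single, deviationUtility_single_eq_sum_update U σ i a b,
    ← Finset.sum_sub_distrib, Finset.mul_sum]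
  refine Finset.sum_congr rfl fun s hs => ?_
  rw [productDist_eq_mul_erase σ i, (Finset.mem_filter.mp hs).2]
  ring

/-- `incentive` as a linear functional of the distribution. -/
def incentiveLinear (U : ι → (∀ i, S i) → ℝ) (i : ι) (a b : S i) : ((∀ i, S i) → ℝ) →ₗ[ℝ] ℝ where
  toFun := incentive U i a b
  map_add' μ ν := by simp [incentive, add_mul, Finset.sum_add_distrib]
  map_smul' r μ := by simp [incentive, mul_assoc, Finset.mul_sum]

theorem incentive_add (U : ι → (∀ i, S i) → ℝ) (i : ι) (a b : S i) (μ ν : (∀ i, S i) → ℝ) :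
    incentive U i a b (μ + ν) = incentive U i a b μ + incentive U i a b ν :=
  map_add (incentiveLinear U i a b) μ ν

theorem incentive_smul (U : ι → (∀ i, S i) → ℝ) (i : ι) (a b : S i) (r : ℝ)
    (μ : (∀ i, S i) → ℝ) : incentive U i a b (r • μ) = r * incentive U i a b μ :=
  map_smul (incentiveLinear U i a b) r μ

theorem incentive_sum (U : ι → (∀ i, S i) → ℝ) (i : ι) (a b : S i) {K : Type*} [Fintype K]
    (μ : K → (∀ i, S i) → ℝ) :
    incentive U i a b (∑ k, μ k) = ∑ k, incentive U i a b (μ k) :=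
  map_sum (incentiveLinear U i a b) μ Finset.univ

theorem incentive_self (U : ι → (∀ i, S i) → ℝ) (i : ι) (a : S i) (μ : (∀ i, S i) → ℝ) :
    incentive U i a a μ = 0 := by
  refine Finset.sum_eq_zero fun s hs => ?_
  rw [← (Finset.mem_filter.mp hs).2, Function.update_eq_self, sub_self, mul_zero]

/-- A correlated equilibrium in which the players randomize independently is a Nash equilibrium. -/
theorem isNashEquilibrium_of_isCorrelatedEquilibrium_productDist {U : ι → (∀ i, S i) → ℝ}
    {σ : ∀ i, S i → ℝ} (hσ : IsMixedProfile σ)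
    (h : IsCorrelatedEquilibrium U (productDist σ)) : IsNashEquilibrium U σ := by
  refine ⟨hσ, fun i τ hτ => ?_⟩
  have hself : expectedUtility U i σ = deviationUtility U σ i (σ i) := by
    rw [deviationUtility, Function.update_eq_self]
  set D : S i → ℝ := fun a => deviationUtility U σ i (Pi.single a 1) with hD
  have hle : ∀ b, D b ≤ ∑ a, σ i a * D a := fun b => by
    have : ∑ a, σ i a * D b ≤ ∑ a, σ i a * D a := Finset.sum_le_sum fun a _ => by
      have := h.2 i a b
      rw [incentive_productDist] at this
      simp only [hD]
      linarith
    rwa [← Finset.sum_mul, (hσ i).2, one_mul] at this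
  rw [hself, deviationUtility_eq_sum, deviationUtility_eq_sum U σ i (σ i)]
  calc ∑ b, τ b * D b ≤ ∑ b, τ b * ∑ a, σ i a * D a :=
        Finset.sum_le_sum fun b _ => mul_le_mul_of_nonneg_left (hle b) (hτ.1 b)
    _ = ∑ a, σ i a * D a := by rw [← Finset.sum_mul, hτ.2, one_mul]

/-! ### Dual vectors -/

/-- Dual vectors of the linear system that defines correlated equilibria: multipliers `α` of the
incentive constraints and multipliers `β` of the nonnegativity constraints. -/
structure IsDualVector (U : ι → (∀ i, S i) → ℝ) (α : ∀ i, S i → S i → ℝ)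
    (β : (∀ i, S i) → ℝ) : Prop where
  nonneg : ∀ i a b, 0 ≤ α i a b
  slack_nonneg : ∀ s, 0 ≤ β s
  sum_eq_zero : ∀ μ : (∀ i, S i) → ℝ,
    ∑ s, μ s * β s + ∑ i, ∑ a, ∑ b, α i a b * incentive U i a b μ = 0

theorem exists_isCorrelatedEquilibrium_eq_smul {U : ι → (∀ i, S i) → ℝ} {x : (∀ i, S i) → ℝ}
    (hx : ∀ s, 0 ≤ x s) (hinc : ∀ i a b, 0 ≤ incentive U i a b x) (hne : x ≠ 0) :
    ∃ r : ℝ, 0 < r ∧ IsCorrelatedEquilibrium U (r • x) := by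
  obtain ⟨s, hs⟩ : ∃ s, x s ≠ 0 := by
    by_contra! h
    exact hne (funext h)
  have hpos : 0 < ∑ s, x s :=
    Finset.sum_pos' (fun s _ => hx s) ⟨s, Finset.mem_univ s, lt_of_le_of_ne (hx s) hs.symm⟩
  refine ⟨(∑ s, x s)⁻¹, inv_pos.mpr hpos, ⟨fun s => ?_, ?_⟩, fun i a b => ?_⟩
  · exact mul_nonneg (inv_nonneg.mpr hpos.le) (hx s)
  · simp only [Pi.smul_apply, smul_eq_mul, ← Finset.mul_sum]
    exact inv_mul_cancel₀ hpos.ne'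
  · rw [incentive_smul]
    exact mul_nonneg (inv_nonneg.mpr hpos.le) (hinc i a b)

/-- There is a dual vector that is strictly complementary to the correlated equilibria. -/
theorem exists_isDualVector_strictly_complementary (U : ι → (∀ i, S i) → ℝ) :
    ∃ α β, IsDualVector U α β ∧
      (∀ s, 0 < β s ∨ ∃ μ, IsCorrelatedEquilibrium U μ ∧ 0 < μ s) ∧
      ∀ i a b, 0 < α i a b ∨ ∃ μ, IsCorrelatedEquilibrium U μ ∧ 0 < incentive U i a b μ := by
  let L : (∀ i, S i) ⊕ (Σ i, S i × S i) → ((∀ i, S i) → ℝ) →ₗ[ℝ] ℝ :=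
    Sum.elim (fun s => LinearMap.proj s) (fun k => incentiveLinear U k.1 k.2.1 k.2.2)
  obtain ⟨c, hc, hsum, hcomp⟩ := exists_strictly_complementary L
  have hnormalize : ∀ k, (∃ x, (∀ j, 0 ≤ L j x) ∧ 0 < L k x) →
      ∃ μ, IsCorrelatedEquilibrium U μ ∧ 0 < L k μ := by
    rintro k ⟨x, hx, hk⟩
    obtain ⟨r, hr, hce⟩ := exists_isCorrelatedEquilibrium_eq_smul (U := U) (x := x)
      (fun s => hx (Sum.inl s)) (fun i a b => hx (Sum.inr ⟨i, a, b⟩))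
      (fun h => by simp [h] at hk)
    exact ⟨r • x, hce, by simpa using mul_pos hr hk⟩
  refine ⟨fun i a b => c (Sum.inr ⟨i, a, b⟩), fun s => c (Sum.inl s),
    ⟨fun _ _ _ => hc _, fun _ => hc _, fun μ => ?_⟩, fun s => ?_, fun i a b => ?_⟩
  · have := congrArg (fun g => g μ) hsum
    simp only [LinearMap.sum_apply, LinearMap.smul_apply, smul_eq_mul, LinearMap.zero_apply] at this
    simp only [Fintype.sum_sum_type, Fintype.sum_sigma, Fintype.sum_prod_type] at this
    rw [← this]
    congr 1
    exact Finset.sum_congr rfl fun s _ => mul_comm (μ s) _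
  · exact (hcomp (Sum.inl s)).imp_right (hnormalize (Sum.inl s))
  · exact (hcomp (Sum.inr ⟨i, a, b⟩)).imp_right (hnormalize (Sum.inr ⟨i, a, b⟩))

/-- If all players but `i` use balanced strategies, then the expected slack of a dual vector, when
`i` plays `a`, is the expected gain of player `i`. -/
theorem IsDualVector.sum_productDist_update_mul {U : ι → (∀ i, S i) → ℝ}
    {α : ∀ i, S i → S i → ℝ} {β : (∀ i, S i) → ℝ} (h : IsDualVector U α β) {σ : ∀ i, S i → ℝ}
    {i : ι} (hσ : ∀ j, j ≠ i → Balanced (α j) (σ j)) (a : S i) :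
    ∑ s, productDist (Function.update σ i (Pi.single a 1)) s * β s =
      ∑ b, α i a b *
        (deviationUtility U σ i (Pi.single b 1) - deviationUtility U σ i (Pi.single a 1)) := by
  set σ' := Function.update σ i (Pi.single a 1) with hσ'
  have hD : ∀ b, deviationUtility U σ' i (Pi.single b 1) =
      deviationUtility U σ i (Pi.single b 1) := fun b => by
    rw [deviationUtility, hσ', Function.update_idem, deviationUtility]
  -- In the dual identity at this distribution, the terms of the other players vanish by balance,
  -- and that of `i` reduces to the row `a`.
  have hsum := h.sum_eq_zero (productDist σ')
  have hplayer : ∀ j, ∑ c, ∑ b, α j c b * incentive U j c b (productDist σ') =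
      -∑ c, σ' j c * ∑ b, α j c b *
        (deviationUtility U σ' j (Pi.single b 1) - deviationUtility U σ' j (Pi.single c 1)) := by
    intro j
    rw [← Finset.sum_neg_distrib]
    refine Finset.sum_congr rfl fun c _ => ?_
    rw [Finset.mul_sum, ← Finset.sum_neg_distrib]
    refine Finset.sum_congr rfl fun b _ => ?_
    rw [incentive_productDist]
    ring
  rw [Finset.sum_eq_single i] at hsum
  · rw [hplayer, Finset.sum_eq_single a] at hsum
    · simp only [hD] at hsum
      simp only [hσ', Function.update_self, Pi.single_eq_same, one_mul] at hsum
      rw [← hσ'] at hsum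
      linarith
    · intro c _ hc
      simp [hσ', hc]
    · simp
  · intro j _ hj
    have hbal : Balanced (α j) (σ' j) := by
      rw [hσ', Function.update_of_ne hj]
      exact hσ j hj
    rw [hplayer, hbal.sum_mul_gain fun c => deviationUtility U σ' j (Pi.single c 1), neg_zero]
  · simp

/-- The gain is an expected slack. Thus the payoff of `i`, as a function of the pure strategy, is
subharmonic for `α i`, as the maximum principle requires. -/
theorem IsDualVector.gain_nonneg {U : ι → (∀ i, S i) → ℝ}
    {α : ∀ i, S i → S i → ℝ} {β : (∀ i, S i) → ℝ} (h : IsDualVector U α β) {σ : ∀ i, S i → ℝ}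
    (hmix : IsMixedProfile σ) {i : ι} (hσ : ∀ j, j ≠ i → Balanced (α j) (σ j)) (a : S i) :
    0 ≤ ∑ b, α i a b *
      (deviationUtility U σ i (Pi.single b 1) - deviationUtility U σ i (Pi.single a 1)) := by
  rw [← h.sum_productDist_update_mul hσ a]
  exact Finset.sum_nonneg fun s _ => mul_nonneg
    (productDist_nonneg (isMixedProfile_update hmix (single_mem_stdSimplex ℝ a)) s)
    (h.slack_nonneg s)

/-! ### Dual reduction -/

section Reduction

/-- The mixed profile carried by a profile of recurrent classes. -/
noncomputable def classProfile {α : ∀ i, S i → S i → ℝ} (t : ∀ i, RecurrentClass (α i)) :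
    ∀ i, S i → ℝ :=
  fun i => (t i).dist

/-- The utility functions of the dual reduction of a game. -/
noncomputable def reducedUtility (U : ι → (∀ i, S i) → ℝ) (α : ∀ i, S i → S i → ℝ) :
    ι → (∀ i, RecurrentClass (α i)) → ℝ :=
  fun i t => expectedUtility U i (classProfile t)

/-- The distribution over the profiles of a game induced by one over the profiles of its dual
reduction. -/
noncomputable def liftDist {α : ∀ i, S i → S i → ℝ} (ν : (∀ i, RecurrentClass (α i)) → ℝ) :
    (∀ i, S i) → ℝ :=
  ∑ t, ν t • productDist (classProfile t)

theorem isMixedProfile_classProfile {α : ∀ i, S i → S i → ℝ} (t : ∀ i, RecurrentClass (α i)) :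
    IsMixedProfile (classProfile t) := fun i => (t i).dist_mem

theorem classProfile_update {α : ∀ i, S i → S i → ℝ} (t : ∀ i, RecurrentClass (α i)) (i : ι)
    (u : RecurrentClass (α i)) :
    classProfile (Function.update t i u) = Function.update (classProfile t) i u.dist := by
  funext j
  by_cases hj : j = i
  · subst hj
    simp [classProfile]
  · simp [classProfile, hj]

theorem liftDist_mem_stdSimplex {α : ∀ i, S i → S i → ℝ} {ν : (∀ i, RecurrentClass (α i)) → ℝ}
    (hν : ν ∈ stdSimplex ℝ (∀ i, RecurrentClass (α i))) :
    liftDist ν ∈ stdSimplex ℝ (∀ i, S i) :=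
  (convex_stdSimplex ℝ _).sum_mem (fun t _ => hν.1 t) hν.2
    fun t _ => productDist_mem_stdSimplex (isMixedProfile_classProfile t)

theorem liftDist_productDist {α : ∀ i, S i → S i → ℝ} (τ : ∀ i, RecurrentClass (α i) → ℝ) :
    liftDist (productDist τ) = productDist fun i => ∑ u, τ i u • RecurrentClass.dist u := by
  funext s
  simp only [liftDist, Finset.sum_apply, Pi.smul_apply, smul_eq_mul, productDist, classProfile]
  rw [Fintype.prod_sum]
  exact Finset.sum_congr rfl fun t _ => Finset.prod_mul_distrib.symm

/-- Classes are disjoint, so a profile `s` with `s i` in the class `t i` receives mass from `t`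
alone. -/
theorem liftDist_injective {α : ∀ i, S i → S i → ℝ} (hα : ∀ i a b, 0 ≤ α i a b) :
    Function.Injective (liftDist (α := α)) := by
  intro ν ν' h
  funext t
  choose s hs using fun i => (t i).exists_dist_pos
  have hval : ∀ ν : (∀ i, RecurrentClass (α i)) → ℝ,
      liftDist ν s = ν t * productDist (classProfile t) s := fun ν => by
    simp only [liftDist, Finset.sum_apply, Pi.smul_apply, smul_eq_mul]
    refine Finset.sum_eq_single t (fun t' _ ht' => ?_) (by simp)
    obtain ⟨i, hi⟩ := Function.ne_iff.mp ht'
    have : (t' i).dist (s i) = 0 := le_antisymm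
      (not_lt.mp fun hpos => hi (RecurrentClass.eq_of_dist_pos (hα i) hpos (hs i)))
      ((t' i).dist_mem.1 _)
    rw [productDist, Finset.prod_eq_zero (Finset.mem_univ i) this, mul_zero]
  have hpos : 0 < productDist (classProfile t) s := Finset.prod_pos fun i _ => hs i
  have := congrFun h s
  rw [hval, hval] at this
  exact mul_right_cancel₀ hpos.ne' this

/-- Correlated equilibria of the dual reduction induce correlated equilibria of the game. -/
theorem IsDualVector.isCorrelatedEquilibrium_liftDist {U : ι → (∀ i, S i) → ℝ}
    {α : ∀ i, S i → S i → ℝ} {β : (∀ i, S i) → ℝ} (h : IsDualVector U α β)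
    {ν : (∀ i, RecurrentClass (α i)) → ℝ}
    (hν : IsCorrelatedEquilibrium (reducedUtility U α) ν) :
    IsCorrelatedEquilibrium U (liftDist ν) := by
  refine ⟨liftDist_mem_stdSimplex hν.1, fun i a b => ?_⟩
  let D : (∀ i, RecurrentClass (α i)) → S i → ℝ :=
    fun t a => deviationUtility U (classProfile t) i (Pi.single a 1)
  -- The unnormalized expected payoff of `a` to player `i` when the class `u` is recommended.
  let f : RecurrentClass (α i) → S i → ℝ := fun u a => ∑ t with t i = u, ν t * D t a
  have hinc : incentive U i a b (liftDist ν) = ∑ u, u.dist a * (f u a - f u b) := by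
    rw [liftDist, incentive_sum, ← Finset.sum_fiberwise Finset.univ (fun t => t i)]
    refine Finset.sum_congr rfl fun u _ => ?_
    rw [← Finset.sum_sub_distrib, Finset.mul_sum]
    refine Finset.sum_congr rfl fun t ht => ?_
    rw [incentive_smul, incentive_productDist, ← (Finset.mem_filter.mp ht).2]
    simp only [classProfile, D]
    ring
  have havg : ∀ u u', ∑ a, u'.dist a * f u a =
      ∑ t with t i = u, ν t * reducedUtility U α i (Function.update t i u') := by
    intro u u'
    simp only [f, Finset.mul_sum]
    rw [Finset.sum_comm]
    refine Finset.sum_congr rfl fun t _ => ?_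
    rw [reducedUtility, classProfile_update, ← deviationUtility, deviationUtility_eq_sum,
      Finset.mul_sum]
    exact Finset.sum_congr rfl fun a _ => by simp only [D]; ring
  have hsub : ∀ u a, 0 ≤ ∑ b, α i a b * (f u b - f u a) := by
    intro u a
    have : ∑ b, α i a b * (f u b - f u a) =
        ∑ t with t i = u, ν t * ∑ b, α i a b * (D t b - D t a) := by
      simp only [f, ← Finset.sum_sub_distrib, Finset.mul_sum]
      rw [Finset.sum_comm]
      exact Finset.sum_congr rfl fun t _ => Finset.sum_congr rfl fun b _ => by ring
    rw [this]
    exact Finset.sum_nonneg fun t _ => mul_nonneg (hν.1.1 t)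
      (h.gain_nonneg (isMixedProfile_classProfile t) (fun j _ => (t j).balanced_dist) a)
  -- The incentive constraints of the reduction compare class averages of `f u`; the maximum
  -- principle extends the bound to every pure strategy.
  have hmax : ∀ u a, f u a ≤ ∑ c, u.dist c * f u c := by
    intro u
    refine le_of_forall_recurrentClass_le (h.nonneg i) (hsub u) fun u' => ?_
    have hce := hν.2 i u u'
    have : incentive (reducedUtility U α) i u u' ν =
        ∑ c, u.dist c * f u c - ∑ c, u'.dist c * f u c := by
      rw [havg, havg, ← Finset.sum_sub_distrib]
      refine Finset.sum_congr rfl fun t ht => ?_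
      rw [mul_sub, ← (Finset.mem_filter.mp ht).2, Function.update_eq_self]
    linarith
  rw [hinc]
  refine Finset.sum_nonneg fun u _ => ?_
  rcases (u.dist_mem.1 a).eq_or_lt with ha | ha
  · rw [← ha, zero_mul]
  -- An average equal to an upper bound forces `f u` to attain the bound wherever `u.dist` is
  -- positive.
  · have hterm : ∀ c ∈ Finset.univ, u.dist c * f u c ≤ u.dist c * ∑ d, u.dist d * f u d :=
      fun c _ => mul_le_mul_of_nonneg_left (hmax u c) (u.dist_mem.1 c)
    have heq := (Finset.sum_eq_sum_iff_of_le hterm).mp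
      (by rw [← Finset.sum_mul, u.dist_mem.2, one_mul]) a (Finset.mem_univ a)
    have hfa := mul_left_cancel₀ ha.ne' heq
    have := hmax u b
    exact mul_nonneg ha.le (by linarith)

/-- A Nash equilibrium of the dual reduction induces a balanced Nash equilibrium of the game. -/
theorem IsDualVector.exists_balanced_productDist {U : ι → (∀ i, S i) → ℝ}
    {α : ∀ i, S i → S i → ℝ} {β : (∀ i, S i) → ℝ} (h : IsDualVector U α β)
    {τ : ∀ i, RecurrentClass (α i) → ℝ} (hτ : IsMixedProfile τ)
    (hce : IsCorrelatedEquilibrium (reducedUtility U α) (productDist τ)) :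
    ∃ σ : ∀ i, S i → ℝ, IsMixedProfile σ ∧ (∀ i, Balanced (α i) (σ i)) ∧
      IsCorrelatedEquilibrium U (productDist σ) := by
  refine ⟨fun i => ∑ u, τ i u • RecurrentClass.dist u, fun i => ?_, fun i => ?_, ?_⟩
  · exact (convex_stdSimplex ℝ _).sum_mem (fun u _ => (hτ i).1 u) (hτ i).2 fun u _ => u.dist_mem
  · exact Balanced.sum _ fun u _ => u.balanced_dist.smul _
  · rw [← liftDist_productDist]
    exact h.isCorrelatedEquilibrium_liftDist hce

end Reduction

/-! ### Product equilibria from uniqueness -/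

/-- If a correlated equilibrium charges all profiles and satisfies all nontrivial incentive
constraints strictly, and it is unique, then there is only one profile. -/
theorem subsingleton_of_strict_of_unique {U : ι → (∀ i, S i) → ℝ} {μ : (∀ i, S i) → ℝ}
    (hμ : IsCorrelatedEquilibrium U μ) (huniq : ∀ ν, IsCorrelatedEquilibrium U ν → ν = μ)
    (hpos : ∀ s, 0 < μ s) (hinc : ∀ i a b, a ≠ b → 0 < incentive U i a b μ) :
    Subsingleton (∀ i, S i) := by
  refine ⟨fun s t => ?_⟩
  by_contra hst
  -- Moving a little mass from `t` to `s` preserves the strict inequalities and gives a second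
  -- equilibrium.
  let d : (∀ i, S i) → ℝ := Pi.single s 1 - Pi.single t 1
  have hlin : ∀ {p : ℝ} (q : ℝ), 0 < p → ∀ᶠ r in nhdsWithin (0 : ℝ) (Set.Ioi 0), 0 ≤ p + r * q := by
    intro p q hp
    have hcont : Filter.Tendsto (fun r : ℝ => p + r * q) (nhds 0) (nhds p) := by
      have : Continuous fun r : ℝ => p + r * q := by fun_prop
      simpa using this.tendsto 0
    exact ((hcont.mono_left nhdsWithin_le_nhds).eventually (lt_mem_nhds hp)).mono fun r hr => hr.le
  have h₁ : ∀ᶠ r in nhdsWithin (0 : ℝ) (Set.Ioi 0), ∀ u, 0 ≤ μ u + r * d u :=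
    Filter.eventually_all.mpr fun u => hlin _ (hpos u)
  have h₂ : ∀ᶠ r in nhdsWithin (0 : ℝ) (Set.Ioi 0), ∀ i a b,
      0 ≤ incentive U i a b μ + r * incentive U i a b d := by
    refine Filter.eventually_all.mpr fun i => Filter.eventually_all.mpr fun a =>
      Filter.eventually_all.mpr fun b => ?_
    by_cases hab : a = b
    · subst hab
      simp [incentive_self]
    · exact hlin _ (hinc i a b hab)
  obtain ⟨r, ⟨hr₁, hr₂⟩, hr⟩ := ((h₁.and h₂).and self_mem_nhdsWithin).exists
  have hce : IsCorrelatedEquilibrium U (μ + r • d) := by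
    refine ⟨⟨fun u => hr₁ u, ?_⟩, fun i a b => ?_⟩
    · simp [Finset.sum_add_distrib, hμ.1.2, d, ← Finset.mul_sum]
    · rw [incentive_add, incentive_smul]
      exact hr₂ i a b
  have := congrFun (huniq _ hce) s
  have hr : (0 : ℝ) < r := hr
  simp [d, hst, hr.ne'] at this

/-- A game with at most one correlated equilibrium has a correlated equilibrium in which the
players randomize independently. -/
theorem exists_isCorrelatedEquilibrium_productDist {S : ι → Type*} [∀ i, Fintype (S i)]
    [∀ i, DecidableEq (S i)] [∀ i, Nonempty (S i)] (U : ι → (∀ i, S i) → ℝ)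
    (huniq : ∀ μ ν, IsCorrelatedEquilibrium U μ → IsCorrelatedEquilibrium U ν → μ = ν) :
    ∃ σ : ∀ i, S i → ℝ, IsMixedProfile σ ∧ IsCorrelatedEquilibrium U (productDist σ) := by
  induction hn : ∑ i, Fintype.card (S i) using Nat.strong_induction_on generalizing S with
  | _ n ih =>
  obtain ⟨α, β, hdual, hβ, hα⟩ := exists_isDualVector_strictly_complementary U
  -- If so, `β` vanishes too. Complementarity then supplies an equilibrium for each strict
  -- inequality, and uniqueness makes them one.
  by_cases htriv : ∀ i a b, a ≠ b → α i a b = 0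
  · have hβ₀ : ∀ s, β s = 0 := fun s => by
      have := hdual.sum_eq_zero (Pi.single s 1)
      rw [Finset.sum_eq_zero (s := Finset.univ) (f := fun i => ∑ a, ∑ b, _)] at this
      · simpa [Pi.single_apply] using this
      · refine fun i _ => Finset.sum_eq_zero fun a _ => Finset.sum_eq_zero fun b _ => ?_
        by_cases hab : a = b
        · rw [hab, incentive_self, mul_zero]
        · rw [htriv i a b hab, zero_mul]
    obtain ⟨s₀⟩ : Nonempty (∀ i, S i) := inferInstance
    obtain ⟨μ, hμ, -⟩ := (hβ s₀).resolve_left (by simp [hβ₀])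
    have hsub : Subsingleton (∀ i, S i) := by
      refine subsingleton_of_strict_of_unique hμ (fun ν hν => huniq _ _ hν hμ) (fun s => ?_)
        (fun i a b hab => ?_)
      · obtain ⟨ν, hν, hpos⟩ := (hβ s).resolve_left (by simp [hβ₀])
        rwa [huniq μ ν hμ hν]
      · obtain ⟨ν, hν, hpos⟩ := (hα i a b).resolve_left (by simp [htriv i a b hab])
        rwa [huniq μ ν hμ hν]
    have hmix : IsMixedProfile fun i => (Pi.single (s₀ i) 1 : S i → ℝ) :=
      fun i => single_mem_stdSimplex ℝ (s₀ i)
    refine ⟨_, hmix, productDist_mem_stdSimplex hmix, fun i a b => ?_⟩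
    refine (Finset.sum_eq_zero fun s _ => ?_).ge
    rw [Subsingleton.elim (Function.update s i b) s, sub_self, mul_zero]
  · push Not at htriv
    obtain ⟨i, a, b, hab, hne⟩ := htriv
    have hlt : ∑ j, Fintype.card (RecurrentClass (α j)) < n := by
      rw [← hn]
      exact Finset.sum_lt_sum (fun j _ => RecurrentClass.card_le (hdual.nonneg j))
        ⟨i, Finset.mem_univ i, RecurrentClass.card_lt (hdual.nonneg i) hab hne⟩
    have : ∀ j, Nonempty (RecurrentClass (α j)) := fun j =>
      RecurrentClass.nonempty (hdual.nonneg j)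
    obtain ⟨τ, hτ, hce⟩ := ih _ hlt (reducedUtility U α) (fun ν ν' hν hν' =>
      liftDist_injective hdual.nonneg (huniq _ _ (hdual.isCorrelatedEquilibrium_liftDist hν)
        (hdual.isCorrelatedEquilibrium_liftDist hν'))) rfl
    obtain ⟨σ, hσ, -, hσce⟩ := hdual.exists_balanced_productDist hτ hce
    exact ⟨σ, hσ, hσce⟩

end Game

end FiniteGame

/-! ### Quasi-strictness -/

open FiniteGame in
theorem mainTheorem2 {ι : Type*} [Fintype ι] [DecidableEq ι]
    {S : ι → Type*} [∀ i, Fintype (S i)] [∀ i, DecidableEq (S i)]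
    (U : ι → (∀ i, S i) → ℝ) (μ : (∀ i, S i) → ℝ)
    (hμ : FiniteGame.IsCorrelatedEquilibrium U μ)
    (huniq : ∀ ν : (∀ i, S i) → ℝ, FiniteGame.IsCorrelatedEquilibrium U ν → ν = μ) :
    ∃ σ : ∀ i, S i → ℝ, μ = FiniteGame.productDist σ ∧ FiniteGame.IsQuasiStrictNash U σ := by
  have hS : ∀ i, Nonempty (S i) := by
    by_contra! hempty
    obtain ⟨i, hi⟩ := hempty
    have : IsEmpty (∀ i, S i) := ⟨fun s => hi.elim (s i)⟩
    have hsum := hμ.1.2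
    simp at hsum
  obtain ⟨α, β, hdual, hβ, -⟩ := exists_isDualVector_strictly_complementary U
  have : ∀ i, Nonempty (RecurrentClass (α i)) := fun i => RecurrentClass.nonempty (hdual.nonneg i)
  -- Existence is applied to the reduction, not to the game itself, so that the lifted `σ` is
  -- balanced for this very `α`.
  obtain ⟨τ, hτ, hτce⟩ := exists_isCorrelatedEquilibrium_productDist (reducedUtility U α)
    fun ν ν' hν hν' => liftDist_injective hdual.nonneg <|
      (huniq _ (hdual.isCorrelatedEquilibrium_liftDist hν)).trans
        (huniq _ (hdual.isCorrelatedEquilibrium_liftDist hν')).symm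
  obtain ⟨σ, hσ, hbal, hce⟩ := hdual.exists_balanced_productDist hτ hτce
  have hσμ := huniq _ hce
  refine ⟨σ, hσμ.symm, isNashEquilibrium_of_isCorrelatedEquilibrium_productDist hσ hce,
    fun i a ha => ?_⟩
  by_contra hnot
  have hzero : σ i a = 0 := le_antisymm (not_lt.mp hnot) ((hσ i).1 a)
  have hslack : ∀ s : ∀ i, S i, s i = a → 0 < β s := fun s hs => by
    refine (hβ s).resolve_right ?_
    rintro ⟨ν, hν, hpos⟩
    rw [huniq ν hν, ← hσμ, productDist_eq_mul_erase σ i, hs, hzero, zero_mul] at hpos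
    exact lt_irrefl _ hpos
  have hdev : IsMixedProfile (Function.update σ i (Pi.single a 1)) :=
    isMixedProfile_update hσ (single_mem_stdSimplex ℝ a)
  have hgain := hdual.sum_productDist_update_mul (i := i) (fun j _ => hbal j) a
  have hnonpos : ∑ b, α i a b * (deviationUtility U σ i (Pi.single b 1) -
      deviationUtility U σ i (Pi.single a 1)) ≤ 0 :=
    Finset.sum_nonpos fun b _ => mul_nonpos_of_nonneg_of_nonpos (hdual.nonneg i a b)
      (sub_nonpos.mpr (ha b))
  have hterm : ∀ s ∈ Finset.univ,
      0 ≤ productDist (Function.update σ i (Pi.single a 1)) s * β s := fun s _ =>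
    mul_nonneg (productDist_nonneg hdev s) (hdual.slack_nonneg s)
  have hall := (Finset.sum_eq_zero_iff_of_nonneg hterm).mp
    (le_antisymm (hgain.trans_le hnonpos) (Finset.sum_nonneg hterm))
  -- The expected slack is zero although `β` is positive wherever `i` plays `a`, so no profile could
  -- carry mass.
  have hdist : ∀ s, productDist (Function.update σ i (Pi.single a 1)) s = 0 := fun s => by
    by_cases hs : s i = a
    · exact (mul_eq_zero.mp (hall s (Finset.mem_univ s))).resolve_right (hslack s hs).ne'
    · rw [productDist_update, Pi.single_eq_of_ne hs, zero_mul]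
  have hone := (productDist_mem_stdSimplex hdev).2
  simp [hdist] at hone
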